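/- Fix an integer $m \geq 2$ and let $\beta_m$ be the multinacci number of order $m$, that is, the unique real solution in $(1,2)$ of $x^m = x^{m-1} + \cdots + x + 1$. For $\beta \in (1,2)$ let $\Delta(\beta) = \{(\beta,\alpha) \in \mathbb{R}^2 : 0 \leq \alpha \leq 2-\beta\}$. For $(\beta,\alpha)\in\Delta(\beta)$ put $p = (1-\alpha)/\beta$ and $J_{\beta,\alpha} = [-\alpha/(\beta-1), (1-\alpha)/(\beta-1)]$, and let $T^{\pm}_{\beta,\alpha} \colon J_{\beta,\alpha} \to J_{\beta,\alpha}$ be given by $$T^{+}_{\beta,\alpha}(x) = \begin{cases} \beta x + \alpha & \text{if } x < p,\\ \beta x + \alpha - 1 & \text{otherwise,}\end{cases} \qquad T^{-}_{\beta,\alpha}(x) = \begin{cases} \beta x + \alpha & \text{if } x \leq p,\\ \beta x + \alpha - 1 & \text{otherwise.}\end{cases}$$ Let $\tau^{\pm}_{\beta,\alpha}(x) = (\omega_1^{\pm}(x), \omega_2^{\pm}(x), \dots) \in \{0,1\}^{\mathbb{N}}$, where, for $n \geq 1$, $\omega_n^{+}(x) = 0$ if $(T^{+}_{\beta,\alpha})^{n-1}(x)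 < p$ and $\omega_n^{+}(x) = 1$ otherwise, and $\omega_n^{-}(x) = 0$ if $(T^{-}_{\beta,\alpha})^{n-1}(x) \leq p$ and $\omega_n^{-}(x) = 1$ otherwise. The intermediate $\beta$-shift is $\Omega_{\beta,\alpha} = \tau^{+}_{\beta,\alpha}(J_{\beta,\alpha}) \cup \tau^{-}_{\beta,\alpha}(J_{\beta,\alpha})$. A subset $\Omega$ of $\{0,1\}^{\mathbb{N}}$ is a subshift of finite type if it is closed in the product topology, invariant under the left shift $\sigma$, and there is a finite set $F$ of finite words such that (i) for every $\nu \in \Omega$ and $n \geq 1$ the word formed by the first $n$ letters of $\nu$ is not in $F$, and (ii) for every $\nu \in \{0,1\}^{\mathbb{N}} \setminus \Omega$ there are integers $n \geq 1$ and $k \geq 0$ such that the word formed by the first $n$ letters of $\sigma^k(\nu)$ is in $F$. Then the set of $(\beta_m,\alpha) \in \Delta(\beta_m)$ for which $\Omega_{\beta_m,\alpha}$ is a subshift of finite type is dense in $\Delta(\beta_m)$. -/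

import Mathlib

namespace IntermediateBeta

open Set

/-! ### Multinacci numbers -/

/-- `β` is a solution in the interval `(1, 2)` of `x ^ m = x ^ (m - 1) + ⋯ + x + 1`. -/
def IsMultinacci (m : ℕ) (β : ℝ) : Prop :=
  β ∈ Ioo (1 : ℝ) 2 ∧ β ^ m = ∑ i ∈ Finset.range m, β ^ i

theorem existsUnique_isMultinacci (m : ℕ) (hm : 2 ≤ m) : ∃! β : ℝ, IsMultinacci m β := by
  have key : ∀ x y : ℝ, IsMultinacci m x → IsMultinacci m y → ¬ x < y := by
    rintro x y ⟨⟨hx1, -⟩, hx⟩ ⟨-, hy⟩ hxy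
    have hx0 : 0 < x := by linarith
    have hr : 1 < y / x := (one_lt_div hx0).2 hxy
    have hlt : ∑ i ∈ Finset.range m, y ^ i < ∑ i ∈ Finset.range m, (y / x) ^ m * x ^ i := by
      apply Finset.sum_lt_sum_of_nonempty
      · exact ⟨0, Finset.mem_range.2 (by omega)⟩
      · intro i hi
        have h1 : y ^ i = (y / x) ^ i * x ^ i := by
          rw [← mul_pow, div_mul_cancel₀ _ hx0.ne']
        rw [h1]
        exact mul_lt_mul_of_pos_right (pow_lt_pow_right₀ hr (Finset.mem_range.1 hi))
          (pow_pos hx0 i)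
    rw [← Finset.mul_sum, ← hx, ← hy, ← mul_pow, div_mul_cancel₀ _ hx0.ne'] at hlt
    exact lt_irrefl _ hlt
  have hcont : ContinuousOn (fun x : ℝ => x ^ m - ∑ i ∈ Finset.range m, x ^ i) (Icc 1 2) := by
    fun_prop
  have h1 : (1 : ℝ) ^ m - ∑ i ∈ Finset.range m, (1 : ℝ) ^ i < 0 := by
    have : (2 : ℝ) ≤ m := by exact_mod_cast hm
    simp
    linarith
  have h2 : (0 : ℝ) < 2 ^ m - ∑ i ∈ Finset.range m, (2 : ℝ) ^ i := by
    rw [geom_sum_eq (by norm_num)]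
    norm_num
  obtain ⟨β, hβ, h0⟩ := intermediate_value_Ioo (by norm_num : (1 : ℝ) ≤ 2) hcont ⟨h1, h2⟩
  refine ⟨β, ⟨hβ, by simpa [sub_eq_zero] using h0⟩, fun y hy => ?_⟩
  have hβ' : IsMultinacci m β := ⟨hβ, by simpa [sub_eq_zero] using h0⟩
  exact le_antisymm (not_lt.1 (key β y hβ' hy)) (not_lt.1 (key y β hy hβ'))

/-- The multinacci number of order `m ≥ 2`. -/
noncomputable def multinacci (m : ℕ) (hm : 2 ≤ m) : ℝ :=
  (existsUnique_isMultinacci m hm).choose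

theorem isMultinacci_multinacci (m : ℕ) (hm : 2 ≤ m) : IsMultinacci m (multinacci m hm) :=
  (existsUnique_isMultinacci m hm).choose_spec.1

/-! ### Intermediate `β`-transformations and `β`-shifts

Infinite words `(ω₁, ω₂, …)` over `{0, 1}` are functions `ω : ℕ → Fin 2`, with `ω n` the letter
`ω_{n+1}`; the set of them carries the product topology. -/

/-- The fibre `Δ(β)`, as a subset of the plane. -/
def fibre (β : ℝ) : Set (ℝ × ℝ) := {x | x.1 = β ∧ 0 ≤ x.2 ∧ x.2 ≤ 2 - β}

/-- The point of discontinuity `p`. -/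
noncomputable def critPt (β α : ℝ) : ℝ := (1 - α) / β

/-- The interval `J` on which the intermediate `β`-transformations act. -/
def domain (β α : ℝ) : Set ℝ := Icc (-α / (β - 1)) ((1 - α) / (β - 1))

/-- The transformation `T⁺`. -/
noncomputable def Tplus (β α x : ℝ) : ℝ :=
  if x < critPt β α then β * x + α else β * x + α - 1

/-- The transformation `T⁻`. -/
noncomputable def Tminus (β α x : ℝ) : ℝ :=
  if x ≤ critPt β α then β * x + α else β * x + α - 1

/-- The expansion map `τ⁺`. -/
noncomputable def tauPlus (β α x : ℝ) : ℕ → Fin 2 :=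
  fun n => if (Tplus β α)^[n] x < critPt β α then 0 else 1

/-- The expansion map `τ⁻`. -/
noncomputable def tauMinus (β α x : ℝ) : ℕ → Fin 2 :=
  fun n => if (Tminus β α)^[n] x ≤ critPt β α then 0 else 1

/-- `Ω⁺`, the image of `J` under `τ⁺`. -/
def OmegaPlus (β α : ℝ) : Set (ℕ → Fin 2) := tauPlus β α '' domain β α

/-- `Ω⁻`, the image of `J` under `τ⁻`. -/
def OmegaMinus (β α : ℝ) : Set (ℕ → Fin 2) := tauMinus β α '' domain β α

/-- The intermediate `β`-shift `Ω = Ω⁺ ∪ Ω⁻`. -/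
def Omega (β α : ℝ) : Set (ℕ → Fin 2) := OmegaPlus β α ∪ OmegaMinus β α

/-! ### Subshifts of finite type -/

/-- The word formed by the first `n` letters of `ω`. -/
def initialWord (ω : ℕ → Fin 2) (n : ℕ) : List (Fin 2) := List.ofFn fun i : Fin n => ω i

/-- A set `Ω` of infinite words is a subshift of finite type: it is a subshift (closed and
shift-invariant) for which there is a finite set `F` of forbidden words such that no nonempty
initial word of an element of `Ω` lies in `F`, while every infinite word outside `Ω` contains
an element of `F`. Here `shift k` is the `k`-th iterate of the left shift. -/
def IsSubshiftOfFiniteType (Ω : Set (ℕ → Fin 2)) : Prop :=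
  ∃ X : SymbolicDynamics.FullShift.Subshift (Fin 2) ℕ, X.carrier = Ω ∧
    ∃ F : Finset (List (Fin 2)),
      (∀ ν ∈ Ω, ∀ n : ℕ, 0 < n → initialWord ν n ∉ F) ∧
      (∀ ν : ℕ → Fin 2, ν ∉ Ω → ∃ n : ℕ, 0 < n ∧ ∃ k : ℕ,
        initialWord (SymbolicDynamics.FullShift.shift k ν) n ∈ F)

end IntermediateBeta

/-!
In the coordinate of `J` one has `T⁻ p = 1` and `T⁺ p = 0`, and both maps preserve `[0, 1]`. The
theorem combines three facts about the two critical orbits, those of `p` under `T⁻` and `T⁺`.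

*Returning critical orbits give finite type* (`isSubshiftOfFiniteType_of_returns`). Let `A` and
`B` be the expansions `τ⁻ p` and `τ⁺ p`, and suppose that the orbits are back at `p` at times `N`
and `M`. Membership in `Ω` is then detected by windows of length `max N M + 1`: by those of the
form `A₀ ⋯ A_{j-1} 1` with `A_j = 0`, `1 ≤ j ≤ N`, which never occur in `Ω`, and by their mirror
images for `B`. Every word `ω` drives a sequence `y` in `J`. If `ω` avoids these windows, then a
digit `0` to the right of `p` would recur at exponentially growing distances from `p`
(`IsReturn.le_of_avoids`), so `y` respects the branches off `p`; and the digit chosen at one visit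
to `p` is chosen at all later ones (`IsReturn.digit_eq_zero_of_visit`), so `ω` is in `Ω⁻` or `Ω⁺`.
The statements for `B` follow from those for `A` by the reflection `x ↦ -x`.

*Matching* (`IsMultinacci.exists_returns`). If `β` is multinacci of order `m` and
`0 < α < 2 - β`, then the critical orbits lie at distance `β ^ j - ∑ i < j, β ^ i` from each other
at time `j + 1`. For `j < m` this is at least `1 / β`, which forces them to lie strictly on both
sides of `p`, and it vanishes for `j = m`. The orbits thus merge before either can return, and
return to `p` together.

*Returns are dense* (`exists_return`). On an interval of parameters without returns the orbit of
`p` under `T⁻` would be affine in `α` with unbounded slopes, although it stays in `[0, 1]`.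
-/

namespace IntermediateBeta

open Set

/-! ### Subshifts determined by windows of bounded length -/

/-- A shift-invariant set that is determined by the windows of length `L` of its elements is a
subshift of finite type: forbid the words of length `L` that do not begin an element of the set.
Closedness follows, as each window depends on finitely many letters. -/
theorem isSubshiftOfFiniteType_of_windows {Ω : Set (ℕ → Fin 2)} {L : ℕ} (hL : 0 < L)
    (hshift : ∀ ν ∈ Ω, ∀ k : ℕ, (fun i => ν (k + i)) ∈ Ω)
    (hwin : ∀ ν : ℕ → Fin 2, (∀ k, ∃ ω ∈ Ω, ∀ i < L, ν (k + i) = ω i) → ν ∈ Ω) :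
    IsSubshiftOfFiniteType Ω := by
  classical
  have hclosed : IsClosed Ω := by
    have hΩ : Ω = ⋂ k : ℕ, (fun (ν : ℕ → Fin 2) (i : Fin L) => ν (k + i)) ⁻¹'
        {f | ∃ ω ∈ Ω, ∀ i : Fin L, f i = ω i} := by
      ext ν
      simp only [mem_iInter, mem_preimage, mem_ofPred_eq]
      refine ⟨fun h k => ⟨_, hshift ν h k, fun i => rfl⟩, fun h => hwin ν fun k => ?_⟩
      obtain ⟨ω, hω, h'⟩ := h k
      exact ⟨ω, hω, fun i hi => h' ⟨i, hi⟩⟩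
    rw [hΩ]
    exact isClosed_iInter fun k => (isClosed_discrete _).preimage (by fun_prop)
  let F : Finset (List (Fin 2)) :=
    (Finset.univ.filter fun f : Fin L → Fin 2 => ∀ ω ∈ Ω, ¬ ∀ i : Fin L, ω i = f i).image List.ofFn
  refine ⟨⟨Ω, hclosed, fun k ν hν => hshift ν hν k⟩, rfl, F, ?_, ?_⟩
  · intro ν hν n _ hF
    obtain ⟨f, hf, hfν⟩ := Finset.mem_image.1 hF
    have hn : L = n := by simpa [initialWord] using congrArg List.length hfν
    subst hn
    have : f = fun i : Fin L => ν i := List.ofFn_injective hfν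
    exact (Finset.mem_filter.1 hf).2 ν hν fun i => by rw [this]
  · intro ν hν
    by_contra hcon
    push Not at hcon
    refine hν (hwin ν fun k => ?_)
    by_contra hk
    push Not at hk
    refine hcon L hL k (Finset.mem_image.2 ⟨fun i => ν (k + i), Finset.mem_filter.2
      ⟨Finset.mem_univ _, fun ω hω h => ?_⟩, rfl⟩)
    obtain ⟨i, hi, hne⟩ := hk ω hω
    exact hne (h ⟨i, hi⟩).symm

/-! ### Affine itineraries -/

/-- The real sequence `y` is driven by the digits `ω`: it follows the branch
`x ↦ β x + α - ω k` at time `k`. -/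
def IsDriven (β α : ℝ) (ω : ℕ → Fin 2) (y : ℕ → ℝ) : Prop :=
  ∀ k, y (k + 1) = β * y k + α - ((ω k : ℕ) : ℝ)

theorem IsDriven.shift {β α : ℝ} {ω : ℕ → Fin 2} {y : ℕ → ℝ} (h : IsDriven β α ω y) (k : ℕ) :
    IsDriven β α (fun i => ω (k + i)) (fun i => y (k + i)) :=
  fun i => h (k + i)

/-- The reflection `x ↦ -x` exchanges the two digits and replaces `α` by `1 - α`. -/
theorem IsDriven.reflect {β α : ℝ} {ω : ℕ → Fin 2} {y : ℕ → ℝ} (h : IsDriven β α ω y) :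
    IsDriven β (1 - α) (fun k => (ω k).rev) (fun k => -y k) := by
  intro k
  have h1 := h k
  rcases (show ω k = 0 ∨ ω k = 1 by omega) with h0 | h0 <;>
    simp [h0] at h1 ⊢ <;> linarith

theorem rev_eq_zero_iff (d : Fin 2) : d.rev = 0 ↔ d ≠ 0 := by
  revert d; decide

/-- Sequences driven by the same digits separate at rate `β`. -/
theorem IsDriven.sub_eq {β α : ℝ} {ω A : ℕ → Fin 2} {y q : ℕ → ℝ} (h : IsDriven β α ω y)
    (hq : IsDriven β α A q) {k j : ℕ} (heq : ∀ i < j, ω (k + i) = A i) :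
    y (k + j) - q j = β ^ j * (y k - q 0) := by
  induction j with
  | zero => simp
  | succ j ih =>
    have h1 := ih fun i hi => heq i (by omega)
    have h2 := h (k + j)
    have h3 := hq j
    rw [heq j (by omega)] at h2
    rw [← add_assoc, h2, h3, pow_succ]
    linear_combination β * h1

/-- The sequence `q`, driven by the digits `A`, starts at `p`, uses the digit `0` exactly when
`q j ≤ p`, and is back at `p` at time `N ≥ 1`. -/
structure IsReturn (β α p : ℝ) (A : ℕ → Fin 2) (q : ℕ → ℝ) (N : ℕ) : Prop where
  driven : IsDriven β α A q
  start : q 0 = p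
  digit : ∀ j, A j = 0 ↔ q j ≤ p
  pos : 0 < N
  back : q N = p

/-- No window of `ω` of the form `A₀ ⋯ A_{j-1} 1` with `1 ≤ j ≤ N` and `A_j = 0`: such a word
is lexicographically larger than `A`. -/
def Avoids (N : ℕ) (A ω : ℕ → Fin 2) : Prop :=
  ∀ k j, 1 ≤ j → j ≤ N → A j = 0 → (∀ i < j, ω (k + i) = A i) → ω (k + j) = 0

namespace IsReturn

variable {β α p : ℝ} {A ω : ℕ → Fin 2} {q y : ℕ → ℝ} {N : ℕ}

theorem digit_zero (h : IsReturn β α p A q N) : A 0 = 0 := (h.digit 0).2 h.start.le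

/-- Expansions under `T⁻` avoid the words larger than `A`: a window that starts like `A` starts at a
point `y k ≤ p`, hence stays to the left of the orbit `q`. -/
theorem avoids_of_le (h : IsReturn β α p A q N) (hβ : 0 < β) (hy : IsDriven β α ω y)
    (hd : ∀ k, ω k = 0 ↔ y k ≤ p) : Avoids N A ω := by
  intro k j hj _ hA heq
  have h1 := hy.sub_eq h.driven heq
  have h2 : ω k = 0 := by simpa [h.digit_zero] using heq 0 (by omega)
  have h3 := (hd k).1 h2
  have h4 : β ^ j * (y k - q 0) ≤ 0 :=
    mul_nonpos_of_nonneg_of_nonpos (by positivity) (by rw [h.start]; linarith)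
  exact (hd _).2 (by linarith [(h.digit j).1 hA])

/-- The analogue of `avoids_of_le` for expansions under `T⁺`. -/
theorem avoids_of_lt (h : IsReturn β α p A q N) (hβ : 0 < β) (hy : IsDriven β α ω y)
    (hd : ∀ k, ω k = 0 ↔ y k < p) : Avoids N A ω := by
  intro k j hj _ hA heq
  have h1 := hy.sub_eq h.driven heq
  have h2 : ω k = 0 := by simpa [h.digit_zero] using heq 0 (by omega)
  have h3 := (hd k).1 h2
  have h4 : β ^ j * (y k - q 0) < 0 :=
    mul_neg_of_pos_of_neg (by positivity) (by rw [h.start]; linarith)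
  exact (hd _).2 (by linarith [(h.digit j).1 hA])

/-- A digit `0` to the right of `p` would recur later at a distance from `p` at least `β` times
larger, so that `y` would be unbounded. -/
theorem le_of_avoids (h : IsReturn β α p A q N) (hβ : 1 < β) (hy : IsDriven β α ω y) {K : ℝ}
    (hK : ∀ k, y k ≤ K) (hav : Avoids N A ω) {k : ℕ} (hk : ω k = 0) : y k ≤ p := by
  by_contra! hlt
  have step : ∀ k, ω k = 0 → p < y k → ∃ l, ω l = 0 ∧ β * (y k - p) ≤ y l - p := by
    intro k hk hlt
    have grow : ∀ j, 1 ≤ j → β * (y k - p) ≤ β ^ j * (y k - p) := fun j hj =>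
      mul_le_mul_of_nonneg_right (le_self_pow₀ hβ.le (by omega)) (by linarith)
    by_cases hall : ∀ i < N, ω (k + i) = A i
    · refine ⟨k + N, hav k N h.pos le_rfl ((h.digit N).2 h.back.le) hall, ?_⟩
      have := hy.sub_eq h.driven hall
      rw [h.back, h.start] at this
      rw [this]
      exact grow N h.pos
    · push Not at hall
      classical
      -- compare with `A` up to the first disagreement
      have hspec := Nat.find_spec hall
      have hmin := fun i (hi : i < Nat.find hall) => Nat.find_min hall hi
      set j := Nat.find hall
      have heq : ∀ i < j, ω (k + i) = A i := fun i hi => by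
        by_contra hne
        exact hmin i hi ⟨by omega, hne⟩
      have hj : 1 ≤ j := by
        by_contra hj0
        have : j = 0 := by omega
        exact hspec.2 (by rw [this, h.digit_zero]; simpa using hk)
      have hAj : A j ≠ 0 := fun h0 => hspec.2 (by rw [h0, hav k j hj hspec.1.le h0 heq])
      have hqj : p < q j := not_le.1 fun hle => hAj ((h.digit j).2 hle)
      have hω : ω (k + j) = 0 := by
        have := hspec.2
        omega
      have := hy.sub_eq h.driven heq
      rw [h.start] at this
      exact ⟨k + j, hω, by linarith [grow j hj]⟩
  have iter : ∀ n : ℕ, ∃ l, ω l = 0 ∧ β ^ n * (y k - p) ≤ y l - p := by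
    intro n
    induction n with
    | zero => exact ⟨k, hk, by simp⟩
    | succ n ih =>
      obtain ⟨l, hl, hle⟩ := ih
      have hpos : 0 < β ^ n * (y k - p) := mul_pos (by positivity) (by linarith)
      obtain ⟨l', hl', hle'⟩ := step l hl (by linarith)
      refine ⟨l', hl', le_trans ?_ hle'⟩
      rw [pow_succ', mul_assoc]
      gcongr
  obtain ⟨n, hn⟩ := pow_unbounded_of_one_lt ((K - p) / (y k - p)) hβ
  obtain ⟨l, -, hl⟩ := iter n
  rw [div_lt_iff₀ (by linarith)] at hn
  linarith [hK l]

/-- From a visit to `p` with digit `0`, the sequence follows `q` up to its return: when `A j = 0`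
the digit is dictated by `hav`, and otherwise `y (k + j) = q j > p`. -/
theorem eq_of_avoids (h : IsReturn β α p A q N) (hy : IsDriven β α ω y)
    (hd : ∀ k, ω k = 0 → y k ≤ p) (hav : Avoids N A ω) {k : ℕ} (hk : ω k = 0) (hkp : y k = p)
    {j : ℕ} (hj : j ≤ N) : ω (k + j) = A j ∧ y (k + j) = q j := by
  induction j using Nat.strong_induction_on with
  | _ j ih =>
    have heq : ∀ i < j, ω (k + i) = A i := fun i hi => (ih i hi (by omega)).1
    have hyq : y (k + j) = q j := by
      have := hy.sub_eq h.driven heq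
      rw [h.start, hkp, sub_self, mul_zero, sub_eq_zero] at this
      exact this
    refine ⟨?_, hyq⟩
    by_cases hA : A j = 0
    · rw [hA]
      rcases Nat.eq_zero_or_pos j with rfl | hj0
      · exact hk
      · exact hav k j hj0 hj hA heq
    · have h1 : ω (k + j) ≠ 0 := fun h0 => hA ((h.digit j).2 (hyq ▸ hd _ h0))
      omega

/-- Once the digit `0` has been used at `p`, it is used at every later visit to `p`. -/
theorem digit_eq_zero_of_visit (h : IsReturn β α p A q N) (hy : IsDriven β α ω y)
    (hd : ∀ k, ω k = 0 → y k ≤ p) (hav : Avoids N A ω) {k l : ℕ} (hkl : k ≤ l) (hk : ω k = 0)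
    (hkp : y k = p) (hl : y l = p) : ω l = 0 := by
  obtain ⟨r, rfl⟩ := Nat.exists_eq_add_of_le hkl
  clear hkl
  induction r using Nat.strong_induction_on generalizing k with
  | _ r ih =>
    by_cases hr : r ≤ N
    · obtain ⟨h1, h2⟩ := h.eq_of_avoids hy hd hav hk hkp hr
      rw [h1, h.digit, ← h2, hl]
    · -- restart at the return time `k + N`, which is again a visit to `p` with digit `0`
      obtain ⟨h1, h2⟩ := h.eq_of_avoids hy hd hav hk hkp le_rfl
      have hN := h.pos
      have he : k + N + (r - N) = k + r := by omega
      have := ih (r - N) (by omega) (k := k + N)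
        (h1.trans ((h.digit N).2 h.back.le)) (h2.trans h.back) (by rw [he]; exact hl)
      rwa [he] at this

end IsReturn

/-! ### Coding by orbits in `J` -/

section Coding

variable {β α : ℝ}

theorem Tminus_mem_domain (hβ : 1 < β) (h0 : 0 ≤ α) (h1 : α ≤ 2 - β) {x : ℝ}
    (hx : x ∈ domain β α) : Tminus β α x ∈ domain β α := by
  obtain ⟨hl, hr⟩ := hx
  have hb : 0 < β - 1 := by linarith
  rw [div_le_iff₀ hb] at hl
  rw [le_div_iff₀ hb] at hr
  unfold Tminus domain critPt
  rw [mem_Icc, div_le_iff₀ hb, le_div_iff₀ hb]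
  split_ifs with h
  · rw [le_div_iff₀ (by linarith)] at h
    constructor <;> nlinarith
  · rw [not_le, div_lt_iff₀ (by linarith)] at h
    constructor <;> nlinarith

theorem Tplus_mem_domain (hβ : 1 < β) (h0 : 0 ≤ α) (h1 : α ≤ 2 - β) {x : ℝ}
    (hx : x ∈ domain β α) : Tplus β α x ∈ domain β α := by
  obtain ⟨hl, hr⟩ := hx
  have hb : 0 < β - 1 := by linarith
  rw [div_le_iff₀ hb] at hl
  rw [le_div_iff₀ hb] at hr
  unfold Tplus domain critPt
  rw [mem_Icc, div_le_iff₀ hb, le_div_iff₀ hb]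
  split_ifs with h
  · rw [lt_div_iff₀ (by linarith)] at h
    constructor <;> nlinarith
  · rw [not_lt, div_le_iff₀ (by linarith)] at h
    constructor <;> nlinarith

theorem isDriven_tauMinus (β α x : ℝ) :
    IsDriven β α (tauMinus β α x) (fun k => (Tminus β α)^[k] x) := by
  intro k
  simp only [Function.iterate_succ_apply', tauMinus]
  by_cases h : (Tminus β α)^[k] x ≤ critPt β α <;> simp [Tminus, h]

theorem isDriven_tauPlus (β α x : ℝ) :
    IsDriven β α (tauPlus β α x) (fun k => (Tplus β α)^[k] x) := by
  intro k
  simp only [Function.iterate_succ_apply', tauPlus]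
  by_cases h : (Tplus β α)^[k] x < critPt β α <;> simp [Tplus, h]

theorem tauMinus_eq_zero_iff (x : ℝ) (k : ℕ) :
    tauMinus β α x k = 0 ↔ (Tminus β α)^[k] x ≤ critPt β α := by
  simp [tauMinus]

theorem tauPlus_eq_zero_iff (x : ℝ) (k : ℕ) :
    tauPlus β α x k = 0 ↔ (Tplus β α)^[k] x < critPt β α := by
  simp [tauPlus]

theorem mem_OmegaMinus_iff (hβ : 1 < β) (h0 : 0 ≤ α) (h1 : α ≤ 2 - β) {ω : ℕ → Fin 2} :
    ω ∈ OmegaMinus β α ↔ ∃ y : ℕ → ℝ, (∀ k, y k ∈ domain β α) ∧ IsDriven β α ω y ∧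
      ∀ k, ω k = 0 ↔ y k ≤ critPt β α := by
  constructor
  · rintro ⟨x, hx, rfl⟩
    refine ⟨fun k => (Tminus β α)^[k] x, fun k => ?_, isDriven_tauMinus β α x,
      tauMinus_eq_zero_iff x⟩
    exact MapsTo.iterate (fun _ => Tminus_mem_domain hβ h0 h1) k hx
  · rintro ⟨y, hJ, hy, hd⟩
    have hyT : ∀ k, y k = (Tminus β α)^[k] (y 0) := by
      intro k
      induction k with
      | zero => rfl
      | succ k ih =>
        rw [Function.iterate_succ_apply', ← ih, hy k, Tminus]
        by_cases h : ω k = 0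
        · rw [if_pos ((hd k).1 h), h]; simp
        · rw [if_neg fun h' => h ((hd k).2 h'), show ω k = 1 by omega]; simp
    refine ⟨y 0, hJ 0, funext fun k => ?_⟩
    by_cases h : ω k = 0
    · rw [h, tauMinus_eq_zero_iff, ← hyT]
      exact (hd k).1 h
    · have : tauMinus β α (y 0) k ≠ 0 := by
        rw [Ne, tauMinus_eq_zero_iff, ← hyT, ← hd]
        exact h
      omega

theorem mem_OmegaPlus_iff (hβ : 1 < β) (h0 : 0 ≤ α) (h1 : α ≤ 2 - β) {ω : ℕ → Fin 2} :
    ω ∈ OmegaPlus β α ↔ ∃ y : ℕ → ℝ, (∀ k, y k ∈ domain β α) ∧ IsDriven β α ω y ∧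
      ∀ k, ω k = 0 ↔ y k < critPt β α := by
  constructor
  · rintro ⟨x, hx, rfl⟩
    refine ⟨fun k => (Tplus β α)^[k] x, fun k => ?_, isDriven_tauPlus β α x,
      tauPlus_eq_zero_iff x⟩
    exact MapsTo.iterate (fun _ => Tplus_mem_domain hβ h0 h1) k hx
  · rintro ⟨y, hJ, hy, hd⟩
    have hyT : ∀ k, y k = (Tplus β α)^[k] (y 0) := by
      intro k
      induction k with
      | zero => rfl
      | succ k ih =>
        rw [Function.iterate_succ_apply', ← ih, hy k, Tplus]
        by_cases h : ω k = 0
        · rw [if_pos ((hd k).1 h), h]; simp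
        · rw [if_neg fun h' => h ((hd k).2 h'), show ω k = 1 by omega]; simp
    refine ⟨y 0, hJ 0, funext fun k => ?_⟩
    by_cases h : ω k = 0
    · rw [h, tauPlus_eq_zero_iff, ← hyT]
      exact (hd k).1 h
    · have : tauPlus β α (y 0) k ≠ 0 := by
        rw [Ne, tauPlus_eq_zero_iff, ← hyT, ← hd]
        exact h
      omega

theorem shift_mem_Omega (hβ : 1 < β) (h0 : 0 ≤ α) (h1 : α ≤ 2 - β) {ω : ℕ → Fin 2}
    (hω : ω ∈ Omega β α) (k : ℕ) : (fun i => ω (k + i)) ∈ Omega β α := by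
  rcases hω with hω | hω
  · obtain ⟨y, hJ, hy, hd⟩ := (mem_OmegaPlus_iff hβ h0 h1).1 hω
    exact Or.inl ((mem_OmegaPlus_iff hβ h0 h1).2
      ⟨_, fun i => hJ (k + i), hy.shift k, fun i => hd (k + i)⟩)
  · obtain ⟨y, hJ, hy, hd⟩ := (mem_OmegaMinus_iff hβ h0 h1).1 hω
    exact Or.inr ((mem_OmegaMinus_iff hβ h0 h1).2
      ⟨_, fun i => hJ (k + i), hy.shift k, fun i => hd (k + i)⟩)

/-- Every digit sequence drives a sequence in `J`, namely that of the values
`∑ n, (ω (k + n) - α) / β ^ (n + 1)` of its tails. -/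
theorem exists_isDriven (hβ : 1 < β) (ω : ℕ → Fin 2) :
    ∃ y : ℕ → ℝ, (∀ k, y k ∈ domain β α) ∧ IsDriven β α ω y := by
  have hb : 0 < β := by linarith
  have hgeo : HasSum (fun n : ℕ => (β⁻¹) ^ (n + 1)) (β - 1)⁻¹ := by
    have := (hasSum_geometric_of_lt_one (inv_nonneg.2 hb.le)
      (inv_lt_one_of_one_lt₀ hβ)).mul_left β⁻¹
    have he : β⁻¹ * (1 - β⁻¹)⁻¹ = (β - 1)⁻¹ := by
      rw [← mul_inv, mul_sub, mul_one, mul_inv_cancel₀ hb.ne']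
    rw [he] at this
    simpa [pow_succ'] using this
  have hdig : ∀ d : Fin 2, (0 : ℝ) ≤ ((d : ℕ) : ℝ) ∧ ((d : ℕ) : ℝ) ≤ 1 := by
    intro d
    refine ⟨by positivity, ?_⟩
    exact_mod_cast (by omega : (d : ℕ) ≤ 1)
  have hsum0 : ∀ k, Summable fun n : ℕ => ((ω (k + n) : ℕ) : ℝ) * (β⁻¹) ^ (n + 1) := fun k =>
    hgeo.summable.of_nonneg_of_le (fun n => mul_nonneg (hdig _).1 (by positivity))
      fun n => mul_le_of_le_one_left (by positivity) (hdig _).2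
  have hsum : ∀ k, Summable fun n : ℕ => (((ω (k + n) : ℕ) : ℝ) - α) * (β⁻¹) ^ (n + 1) := by
    intro k
    simpa [sub_mul] using (hsum0 k).sub (hgeo.summable.mul_left α)
  refine ⟨fun k => ∑' n : ℕ, (((ω (k + n) : ℕ) : ℝ) - α) * (β⁻¹) ^ (n + 1), fun k => ⟨?_, ?_⟩, ?_⟩
  · rw [div_eq_mul_inv]
    refine hasSum_le (fun n => ?_) (hgeo.mul_left (-α)) (hsum k).hasSum
    exact mul_le_mul_of_nonneg_right (by linarith [(hdig (ω (k + n))).1]) (by positivity)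
  · rw [div_eq_mul_inv]
    refine hasSum_le (fun n => ?_) (hsum k).hasSum (hgeo.mul_left (1 - α))
    exact mul_le_mul_of_nonneg_right (by linarith [(hdig (ω (k + n))).2]) (by positivity)
  · intro k
    simp only
    rw [(hsum k).tsum_eq_zero_add]
    have : ∑' n : ℕ, (((ω (k + (n + 1)) : ℕ) : ℝ) - α) * (β⁻¹) ^ (n + 1 + 1)
        = β⁻¹ * ∑' n : ℕ, (((ω (k + 1 + n) : ℕ) : ℝ) - α) * (β⁻¹) ^ (n + 1) := by
      rw [← tsum_mul_left]
      refine tsum_congr fun n => ?_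
      rw [show k + (n + 1) = k + 1 + n by ring, pow_succ _ (n + 1)]
      ring
    rw [this]
    simp only [add_zero, zero_add, pow_one]
    field_simp
    ring

end Coding

/-! ### Returning critical orbits give a subshift of finite type -/

/-- If `ω` avoids all the windows, then it lies outside `Ω` only if it uses the digit `1` at one
visit to `p` and the digit `0` at another, which `IsReturn.digit_eq_zero_of_visit` excludes in
either order. -/
theorem isSubshiftOfFiniteType_of_returns {β α : ℝ} (hβ : 1 < β) (h0 : 0 ≤ α) (h1 : α ≤ 2 - β)
    {N M : ℕ} (hN : 0 < N) (hM : 0 < M)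
    (hminus : (Tminus β α)^[N] (critPt β α) = critPt β α)
    (hplus : (Tplus β α)^[M] (critPt β α) = critPt β α) :
    IsSubshiftOfFiniteType (Omega β α) := by
  have hb : 0 < β := by linarith
  set p := critPt β α with hp
  set A := tauMinus β α p
  set B := tauPlus β α p
  have hA : IsReturn β α p A (fun k => (Tminus β α)^[k] p) N :=
    ⟨isDriven_tauMinus β α p, rfl, tauMinus_eq_zero_iff p, hN, hminus⟩
  have hB : IsReturn β (1 - α) (-p) (fun k => (B k).rev) (fun k => -(Tplus β α)^[k] p) M := by
    refine ⟨(isDriven_tauPlus β α p).reflect, rfl, fun j => ?_, hM, by rw [hplus]⟩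
    rw [rev_eq_zero_iff, Ne, tauPlus_eq_zero_iff, not_lt, neg_le_neg_iff]
  have havoid : ∀ ω ∈ Omega β α, Avoids N A ω ∧ Avoids M (fun k => (B k).rev)
      (fun k => (ω k).rev) := by
    rintro ω (hω | hω)
    · obtain ⟨y, -, hy, hd⟩ := (mem_OmegaPlus_iff hβ h0 h1).1 hω
      refine ⟨hA.avoids_of_lt hb hy hd, hB.avoids_of_le hb hy.reflect fun k => ?_⟩
      rw [rev_eq_zero_iff, Ne, hd, not_lt, neg_le_neg_iff]
    · obtain ⟨y, -, hy, hd⟩ := (mem_OmegaMinus_iff hβ h0 h1).1 hω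
      refine ⟨hA.avoids_of_le hb hy hd, hB.avoids_of_lt hb hy.reflect fun k => ?_⟩
      rw [rev_eq_zero_iff, Ne, hd, not_le, neg_lt_neg_iff]
  -- the forbidden windows consist of the letters `0, …, j` with `j ≤ max N M`
  refine isSubshiftOfFiniteType_of_windows (L := max N M + 1) (by omega)
    (fun ν hν k => shift_mem_Omega hβ h0 h1 hν k) fun ν hν => ?_
  have hνA : Avoids N A ν := by
    intro k j hj hjN hAj heq
    obtain ⟨ω, hω, hag⟩ := hν k
    rw [hag j (by omega)]
    simpa using (havoid ω hω).1 0 j hj hjN hAj fun i hi => by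
      rw [zero_add, ← hag i (by omega), heq i hi]
  have hνB : Avoids M (fun k => (B k).rev) (fun k => (ν k).rev) := by
    intro k j hj hjM hBj heq
    obtain ⟨ω, hω, hag⟩ := hν k
    simp only at heq ⊢
    rw [hag j (by omega)]
    simpa using (havoid ω hω).2 0 j hj hjM hBj fun i hi => by
      simp only
      rw [zero_add, ← hag i (by omega), heq i hi]
  obtain ⟨y, hJ, hy⟩ := exists_isDriven (α := α) hβ ν
  have hd0 : ∀ k, ν k = 0 → y k ≤ p := fun k hk =>
    hA.le_of_avoids hβ hy (fun k => (hJ k).2) hνA hk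
  have hd1 : ∀ k, (ν k).rev = 0 → -y k ≤ -p := fun k hk =>
    hB.le_of_avoids hβ hy.reflect (fun k => neg_le_neg (hJ k).1) hνB hk
  by_contra hcon
  have hm : ∃ l, ν l ≠ 0 ∧ y l ≤ p := by
    by_contra! hno
    exact hcon (Or.inr ((mem_OmegaMinus_iff hβ h0 h1).2 ⟨y, hJ, hy, fun k =>
      ⟨hd0 k, fun hk => by_contra fun hne => absurd hk (not_le.2 (hno k hne))⟩⟩))
  have hpl : ∃ k, ν k = 0 ∧ p ≤ y k := by
    by_contra! hno
    exact hcon (Or.inl ((mem_OmegaPlus_iff hβ h0 h1).2 ⟨y, hJ, hy, fun k =>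
      ⟨hno k, fun hk => by_contra fun hne =>
        absurd hk (not_lt.2 (neg_le_neg_iff.1 (hd1 k ((rev_eq_zero_iff _).2 hne))))⟩⟩))
  obtain ⟨l, hl, hlp⟩ := hm
  obtain ⟨k, hk, hkp⟩ := hpl
  have hl' := (rev_eq_zero_iff _).2 hl
  have hlp' : y l = p := le_antisymm hlp (neg_le_neg_iff.1 (hd1 l hl'))
  have hkp' : y k = p := le_antisymm (hd0 k hk) hkp
  rcases le_total k l with hkl | hkl
  · exact hl (hA.digit_eq_zero_of_visit hy hd0 hνA hkl hk hkp' hlp')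
  · exact (rev_eq_zero_iff _).1 (hB.digit_eq_zero_of_visit hy.reflect hd1 hνB hkl hl'
      (by rw [hlp']) (by rw [hkp'])) hk

/-! ### Matching of the critical orbits at multinacci numbers -/

section Matching

variable {m : ℕ} {β α : ℝ}

/-- The distance between the two critical orbits after `j + 1` steps, before they merge. -/
def gap (β : ℝ) (j : ℕ) : ℝ := β ^ j - ∑ i ∈ Finset.range j, β ^ i

theorem gap_succ (β : ℝ) (j : ℕ) : gap β (j + 1) = β * gap β j - 1 := by
  unfold gap
  rw [Finset.sum_range_succ', mul_sub, Finset.mul_sum]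
  simp only [pow_succ', pow_zero]
  ring

theorem IsMultinacci.gap_eq_zero (h : IsMultinacci m β) : gap β m = 0 := by
  rw [gap, h.2, sub_self]

theorem IsMultinacci.gap_nonneg (h : IsMultinacci m β) {j : ℕ} (hj : j ≤ m) : 0 ≤ gap β j := by
  have hβ := h.1.1
  induction hj using Nat.decreasingInduction with
  | self => exact h.gap_eq_zero.ge
  | of_succ k _ ih =>
    rw [gap_succ] at ih
    by_contra! hneg
    nlinarith

theorem IsMultinacci.one_le_mul_gap (h : IsMultinacci m β) {j : ℕ} (hj : j < m) :
    1 ≤ β * gap β j := by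
  have := h.gap_nonneg (j := j + 1) hj
  rw [gap_succ] at this
  linarith

theorem Tminus_critPt (hβ : 1 < β) : Tminus β α (critPt β α) = 1 := by
  rw [Tminus, if_pos le_rfl, critPt]
  field_simp
  ring

theorem Tplus_critPt (hβ : 1 < β) : Tplus β α (critPt β α) = 0 := by
  rw [Tplus, if_neg (lt_irrefl _), critPt]
  field_simp
  ring

theorem Tminus_mem_Icc (hβ : 1 < β) (h0 : 0 ≤ α) (h1 : α ≤ 2 - β) {x : ℝ}
    (hx : x ∈ Icc (0 : ℝ) 1) : Tminus β α x ∈ Icc (0 : ℝ) 1 := by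
  obtain ⟨hl, hr⟩ := hx
  unfold Tminus critPt
  split_ifs with h
  · rw [le_div_iff₀ (by linarith)] at h
    constructor <;> nlinarith
  · rw [not_le, div_lt_iff₀ (by linarith)] at h
    constructor <;> nlinarith

theorem Tplus_mem_Icc (hβ : 1 < β) (h0 : 0 ≤ α) (h1 : α ≤ 2 - β) {x : ℝ}
    (hx : x ∈ Icc (0 : ℝ) 1) : Tplus β α x ∈ Icc (0 : ℝ) 1 := by
  obtain ⟨hl, hr⟩ := hx
  unfold Tplus critPt
  split_ifs with h
  · rw [lt_div_iff₀ (by linarith)] at h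
    constructor <;> nlinarith
  · rw [not_lt, div_le_iff₀ (by linarith)] at h
    constructor <;> nlinarith

theorem Tminus_iterate_mem_Icc (hβ : 1 < β) (h0 : 0 ≤ α) (h1 : α ≤ 2 - β) (n : ℕ) :
    (Tminus β α)^[n + 1] (critPt β α) ∈ Icc (0 : ℝ) 1 := by
  rw [Function.iterate_succ_apply, Tminus_critPt hβ]
  exact MapsTo.iterate (fun _ => Tminus_mem_Icc hβ h0 h1) n (by simp)

theorem Tplus_iterate_mem_Icc (hβ : 1 < β) (h0 : 0 ≤ α) (h1 : α ≤ 2 - β) (n : ℕ) :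
    (Tplus β α)^[n + 1] (critPt β α) ∈ Icc (0 : ℝ) 1 := by
  rw [Function.iterate_succ_apply, Tplus_critPt hβ]
  exact MapsTo.iterate (fun _ => Tplus_mem_Icc hβ h0 h1) n (by simp)

/-- Points of `[0, 1]` at distance at least `1 / β` lie on different sides of `p`. -/
theorem critPt_between (hβ : 1 < β) (h0 : 0 < α) (h1 : α < 2 - β) {u l : ℝ} (hu : u ≤ 1)
    (hl : 0 ≤ l) (hd : 1 ≤ β * (u - l)) : l < critPt β α ∧ critPt β α < u := by
  have hb : 0 < β := by linarith
  unfold critPt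
  rw [lt_div_iff₀ hb, div_lt_iff₀ hb]
  constructor <;> nlinarith

theorem IsMultinacci.iterate_sub (h : IsMultinacci m β) (h0 : 0 < α) (h1 : α < 2 - β) {j : ℕ}
    (hj : j ≤ m) :
    (Tminus β α)^[j + 1] (critPt β α) - (Tplus β α)^[j + 1] (critPt β α) = gap β j := by
  have hβ := h.1.1
  induction j with
  | zero => simp [Tminus_critPt hβ, Tplus_critPt hβ, gap]
  | succ j ih =>
    have ih := ih (by omega)
    rw [Function.iterate_succ_apply' _ (j + 1), Function.iterate_succ_apply' _ (j + 1), gap_succ,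
      ← ih]
    have hu := Tminus_iterate_mem_Icc hβ h0.le h1.le j
    have hl := Tplus_iterate_mem_Icc hβ h0.le h1.le j
    obtain ⟨h2, h3⟩ := critPt_between hβ h0 h1 hu.2 hl.1
      (by rw [ih]; exact h.one_le_mul_gap (by omega))
    rw [Tminus, if_neg (not_le.2 h3), Tplus, if_pos h2]
    ring

theorem Tminus_eq_Tplus {x : ℝ} (hx : x ≠ critPt β α) : Tminus β α x = Tplus β α x := by
  unfold Tminus Tplus
  rcases lt_or_gt_of_ne hx with h | h
  · rw [if_pos h.le, if_pos h]
  · rw [if_neg (not_le.2 h), if_neg (not_lt.2 h.le)]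

/-- Since the two critical orbits merge before either can be back at `p`, they return together. -/
theorem IsMultinacci.exists_returns (h : IsMultinacci m β) (h0 : 0 < α) (h1 : α < 2 - β)
    (hret : ∃ n, (Tminus β α)^[n + 1] (critPt β α) = critPt β α) :
    ∃ n, (Tminus β α)^[n + 1] (critPt β α) = critPt β α ∧
      (Tplus β α)^[n + 1] (critPt β α) = critPt β α := by
  classical
  have hβ := h.1.1
  have hspec := Nat.find_spec hret
  have hmin := fun i (hi : i < Nat.find hret) => Nat.find_min hret hi
  set n := Nat.find hret
  have hn : m ≤ n := by
    by_contra! hlt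
    have hu := Tminus_iterate_mem_Icc hβ h0.le h1.le n
    have hl := Tplus_iterate_mem_Icc hβ h0.le h1.le n
    have := (critPt_between hβ h0 h1 hu.2 hl.1
      (by rw [h.iterate_sub h0 h1 hlt.le]; exact h.one_le_mul_gap hlt)).2
    exact this.ne' hspec
  have hmerge : ∀ k, m ≤ k → k ≤ n →
      (Tminus β α)^[k + 1] (critPt β α) = (Tplus β α)^[k + 1] (critPt β α) := by
    intro k hk
    induction k, hk using Nat.le_induction with
    | base =>
      intro _
      have := h.iterate_sub h0 h1 le_rfl
      rw [h.gap_eq_zero] at this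
      exact sub_eq_zero.1 this
    | succ k hk ih =>
      intro hkn
      rw [Function.iterate_succ_apply' _ (k + 1), Function.iterate_succ_apply' _ (k + 1),
        ← ih (by omega)]
      exact Tminus_eq_Tplus (hmin k (by omega))
  exact ⟨n, hspec, (hmerge n hn le_rfl) ▸ hspec⟩

end Matching

/-! ### Density of the parameters with a returning critical orbit -/

/-- If the critical orbit never returned for the parameters in an interval, then its digits would
not depend on the parameter there, so the orbit would depend on `α` affinely, with a slope that
grows in time; but the orbit stays in `[0, 1]`. -/
theorem exists_return {β a b : ℝ} (hβ : 1 < β) (ha : 0 ≤ a) (hb : b ≤ 2 - β) (hab : a < b) :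
    ∃ α ∈ Ioo a b, ∃ n, (Tminus β α)^[n + 1] (critPt β α) = critPt β α := by
  by_contra! hno
  have haff : ∀ n : ℕ, ∃ c s : ℝ, n ≤ s ∧ ∀ α ∈ Ioo a b,
      (Tminus β α)^[n + 1] (critPt β α) = c + s * α := by
    intro n
    induction n with
    | zero => exact ⟨1, 0, by simp, fun α _ => by simp [Tminus_critPt hβ]⟩
    | succ n ih =>
      obtain ⟨c, s, hs, hc⟩ := ih
      have hs' : ((n + 1 : ℕ) : ℝ) ≤ β * s + 1 := by
        have : (0 : ℝ) ≤ n := by positivity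
        push_cast
        nlinarith
      have hcont : ContinuousOn (fun α : ℝ => c + s * α - critPt β α) (Ioo a b) := by
        unfold critPt
        fun_prop
      have hne : ∀ α ∈ Ioo a b, c + s * α - critPt β α ≠ 0 := fun α hα h0 =>
        hno α hα n (by rw [hc α hα]; linarith)
      by_cases hneg : ∀ α ∈ Ioo a b, c + s * α - critPt β α ≤ 0
      · refine ⟨β * c, β * s + 1, hs', fun α hα => ?_⟩
        rw [Function.iterate_succ_apply' _ (n + 1), hc α hα, Tminus,
          if_pos (by linarith [hneg α hα])]
        ring
      · push Not at hneg
        obtain ⟨α₁, hα₁, hpos⟩ := hneg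
        refine ⟨β * c - 1, β * s + 1, hs', fun α hα => ?_⟩
        have hα' : 0 < c + s * α - critPt β α := by
          by_contra! hle
          obtain ⟨γ, hγ, h0⟩ := isPreconnected_Ioo.intermediate_value hα hα₁ hcont ⟨hle, hpos.le⟩
          exact hne γ hγ h0
        rw [Function.iterate_succ_apply' _ (n + 1), hc α hα, Tminus, if_neg (by linarith)]
        ring
  obtain ⟨x, hax, hxb⟩ := exists_between hab
  obtain ⟨z, hxz, hzb⟩ := exists_between hxb
  obtain ⟨n, hn⟩ := exists_nat_gt (1 / (z - x))
  obtain ⟨c, s, hs, hc⟩ := haff n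
  have hx := Tminus_iterate_mem_Icc (α := x) hβ (by linarith) (by linarith) n
  have hz := Tminus_iterate_mem_Icc (α := z) hβ (by linarith) (by linarith) n
  rw [hc x ⟨hax, hxb⟩] at hx
  rw [hc z ⟨by linarith, hzb⟩] at hz
  have hlt := hn.trans_le hs
  rw [div_lt_iff₀ (by linarith)] at hlt
  nlinarith [hx.1, hz.2]

end IntermediateBeta

theorem theorem1p1 (m : ℕ) (hm : 2 ≤ m) :
    Dense {x : IntermediateBeta.fibre (IntermediateBeta.multinacci m hm) |
      IntermediateBeta.IsSubshiftOfFiniteType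
        (IntermediateBeta.Omega (x : ℝ × ℝ).1 (x : ℝ × ℝ).2)} := by
  have hmul := IntermediateBeta.isMultinacci_multinacci m hm
  set β := IntermediateBeta.multinacci m hm
  obtain ⟨hβ, hβ2⟩ := hmul.1
  rw [Metric.dense_iff]
  rintro ⟨⟨β', α₀⟩, hβ', h0, h1⟩ ε hε
  simp only at hβ' h0 h1
  obtain ⟨α, ⟨hl, hr⟩, hret⟩ := IntermediateBeta.exists_return (β := β) (a := max 0 (α₀ - ε))
    (b := min (2 - β) (α₀ + ε)) hβ (le_max_left _ _) (min_le_left _ _)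
    (by rw [max_lt_iff, lt_min_iff, lt_min_iff]; constructor <;> constructor <;> linarith)
  rw [max_lt_iff] at hl
  rw [lt_min_iff] at hr
  obtain ⟨n, hminus, hplus⟩ := hmul.exists_returns hl.1 hr.1 hret
  refine ⟨⟨(β, α), rfl, hl.1.le, hr.1.le⟩, ?_, ?_⟩
  · rw [Metric.mem_ball, Subtype.dist_eq, Prod.dist_eq, max_lt_iff]
    refine ⟨by simpa [hβ'] using hε, ?_⟩
    rw [Real.dist_eq, abs_lt]
    constructor <;> simp only <;> linarith
  · exact IntermediateBeta.isSubshiftOfFiniteType_of_returns hβ hl.1.le hr.1.le n.succ_pos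
      n.succ_pos hminus hplus
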